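/- Let $q$ be a prime power and let $E_r(q,n)$ be the set of $r$-dimensional subspaces of $\mathrm{GF}(q)^n$. For subspaces $U,V$ of $\mathrm{GF}(q)^n$ put $d_S(U,V)=\dim(U+V)-\dim(U\cap V)$ (subspace distance) and $d_I(U,V)=\max\{\dim U,\dim V\}-\dim(U\cap V)$ (injection distance). Let $N_S(r,s,e)$ be the number of $s$-dimensional subspaces at subspace distance $e$ from a given $r$-dimensional subspace, and let $J_S(u,s,w;a,b,c)$ be the number of $c$-dimensional subspaces $X$ with $d_S(A,X)=u$ and $d_S(B,X)=s$, where $\dim A=a$, $\dim B=b$, $d_S(A,B)=w$; these numbers depend only on the parameters. An operator channel assigns to every input subspace of $\mathrm{GF}(q)^n$ a probability distribution of the output subspace. If $U$ is sent and $V$ is received, the number of errors is $\dim V-\dim(U\cap V)$ and the number of erasures is $\dim U-\dim(U\cap V)$. The channel is symmetric if for every input all outputs corresponding to the same number of errors and the same number of erasures are equiprobable. The bounded injection distance decoder of radius $t$ for a code outputs a codeword at injection distance at most $t$ from the received subspace if there is one, and declares a failure otherwise; a decoder error occurs when it outputs a codeword different from the sent one. Let $\mathcal C\subseteq E_r(q,n)$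 be a code with minimum injection distance $d$ (over all pairs of distinct codewords, of which there is at least one), let $t=\lfloor (d-1)/2\rfloor$, and let $A_w(C)=|\{D\in\mathcal C: d_I(D,C)=w\}|$. Suppose that $C\in\mathcal C$ is sent over a symmetric operator channel, and let $\Pi(C,\mu,v,t)$ be the decoder error probability, i.e. the conditional probability of a decoder error given that the received subspace has dimension $v$ and is at injection distance $\mu$ from $C$ (taken to be $0$ if this event has probability $0$). (i) If $\mu\ge d-t+|v-r|$ and $|v-r|\le t$, and the event conditioned on has positive probability, then $$\Pi(C,\mu,v,t)=\frac{1}{N_S(r,v,2\mu-|v-r|)}\sum_{w=d}^{r}A_w(C)\sum_{s=0}^{2t-|v-r|}J_S(2\mu-|v-r|,s,2w;r,r,v).$$ (ii) If $\mu< d-t+|v-r|$ or $|v-r|>t$, then $\Pi(C,\mu,v,t)=0$. (iii) Suppose that $2r\le n$ and that $\mathcal C$ is the lifting of a rank metric code, i.e. $\mathcal C=\{I(\mathbf M):\mathbf M\in\mathcal R\}$ for some set $\mathcal R$ of $r\times(n-r)$ matrices over $\mathrm{GF}(q)$, where $I(\mathbf M)$ is the row space of $(\mathbf I_r\,|\,\mathbf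 M)$. Let $K_q=\prod_{j=1}^\infty(1-q^{-j})$ and $L_q=K_q^{-2}\sum_{i=0}^\infty q^{-\frac34 i^2}$. Then for all $\mu$ and $v$ $$\Pi(C,\mu,v,t)<\begin{cases}L_q\,q^{-\left(t+\frac{v-r}{2}\right)\left(n-2r+t-\frac{v-r}{2}\right)-\frac{|v-r|}{2}\left(n-2t+\frac{|v-r|}{2}\right)} & \text{if } d=2t+1,\\[2pt] L_q\,q^{-\left(t+\frac{v-r}{2}\right)\left(n-2r+t-\frac{v-r}{2}\right)-\frac{|v-r|}{2}\left(n-2t+\frac{|v-r|}{2}\right)-n+r} & \text{if } d=2t+2.\end{cases}$$ -/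

import Mathlib

/-! ## Subspaces, distances and lifting -/

/-- The projective space `E(q, n)`: all subspaces of `F ^ n`, where `F = GF(q)`. -/
abbrev PSpace (F : Type*) [Field F] (n : ℕ) : Type _ := Submodule F (Fin n → F)

namespace CDC

open Module

variable {F : Type*} [Field F] {n : ℕ}

/-- Subspace distance `dim (U + V) - dim (U ∩ V)`. -/
noncomputable def dS (U V : PSpace F n) : ℕ :=
  finrank F (U ⊔ V : PSpace F n) - finrank F (U ⊓ V : PSpace F n)

/-- Injection distance `max (dim U) (dim V) - dim (U ∩ V)`. -/
noncomputable def dI (U V : PSpace F n) : ℕ :=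
  max (finrank F U) (finrank F V) - finrank F (U ⊓ V : PSpace F n)

/-- `d` is the minimum injection distance of `𝒞`, over all pairs of distinct codewords. -/
def IsMinInjDist (𝒞 : Set (PSpace F n)) (d : ℕ) : Prop :=
  IsLeast {e : ℕ | ∃ U ∈ 𝒞, ∃ V ∈ 𝒞, U ≠ V ∧ dI U V = e} d

/-- The injection distance distribution `A_w(C)` of the code `𝒞` with respect to `C`. -/
noncomputable def A (𝒞 : Set (PSpace F n)) (C : PSpace F n) (w : ℕ) : ℕ :=
  {D : PSpace F n | D ∈ 𝒞 ∧ dI D C = w}.ncard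

/-- The `r × n` matrix `(I_r | M)`, for an `r × (n - r)` matrix `M`. -/
def idAugment {r : ℕ} (hr : r ≤ n) (M : Matrix (Fin r) (Fin (n - r)) F) :
    Matrix (Fin r) (Fin n) F :=
  Matrix.reindex (Equiv.refl _) (finSumFinEquiv.trans (finCongr (Nat.add_sub_of_le hr)))
    (Matrix.fromCols (1 : Matrix (Fin r) (Fin r) F) M)

/-- The lifting `I(M)`: the row space of `(I_r | M)`. -/
def lift {r : ℕ} (hr : r ≤ n) (M : Matrix (Fin r) (Fin (n - r)) F) : PSpace F n :=
  Submodule.span F (Set.range (idAugment hr M).row)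

/-! ## Numbers of subspaces

`NS` and `JS` are the cardinalities of spheres and of intersections of two spheres (of given
dimension), centered at some chosen subspaces with the prescribed parameters. The lemmas `NS_eq`
and `JS_eq` show that they do not depend on this choice. Both are `0` if there are no centers with
the prescribed parameters. -/

open Classical in
/-- `N_S(r, s, d)`: the number of subspaces of dimension `s` at subspace distance `d` from a
subspace of dimension `r`. -/
noncomputable def NS (F : Type*) [Field F] (n r s d : ℕ) : ℕ :=
  if h : ∃ U : PSpace F n, finrank F U = r then
    {V : PSpace F n | finrank F V = s ∧ dS h.choose V = d}.ncard
  else 0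

open Classical in
/-- `J_S(u, s, w; a, b, c)`: for `dim A = a`, `dim B = b` with `dS A B = w`, the number of
subspaces `X` of dimension `c` such that `dS A X = u` and `dS B X = s`. -/
noncomputable def JS (F : Type*) [Field F] (n u s w a b c : ℕ) : ℕ :=
  if h : ∃ P : PSpace F n × PSpace F n,
      finrank F P.1 = a ∧ finrank F P.2 = b ∧ dS P.1 P.2 = w then
    {X : PSpace F n | finrank F X = c ∧ dS h.choose.1 X = u ∧ dS h.choose.2 X = s}.ncard
  else 0

theorem exists_equiv_glue {V V' : Type*} [AddCommGroup V] [Module F V]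
    [AddCommGroup V'] [Module F V'] {p q : Submodule F V} {p' q' : Submodule F V'}
    (h : IsCompl p q) (h' : IsCompl p' q') (e₁ : p ≃ₗ[F] p') (e₂ : q ≃ₗ[F] q') :
    ∃ e : V ≃ₗ[F] V', (∀ x : p, e x = e₁ x) ∧ (∀ x : q, e x = e₂ x) :=
  ⟨(p.prodEquivOfIsCompl q h).symm ≪≫ₗ (e₁.prodCongr e₂) ≪≫ₗ p'.prodEquivOfIsCompl q' h',
    fun x => by simp, fun x => by simp⟩

theorem exists_equiv_map_eq {V V' : Type*} [AddCommGroup V] [Module F V] [FiniteDimensional F V]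
    [AddCommGroup V'] [Module F V'] [FiniteDimensional F V'] (S : Submodule F V)
    (S' : Submodule F V') (hV : finrank F V = finrank F V') (hS : finrank F S = finrank F S') :
    ∃ e : V ≃ₗ[F] V', S.map (e : V →ₗ[F] V') = S' := by
  obtain ⟨Q, hQ⟩ := S.exists_isCompl
  obtain ⟨Q', hQ'⟩ := S'.exists_isCompl
  have h1 := Submodule.finrank_add_eq_of_isCompl hQ
  have h2 := Submodule.finrank_add_eq_of_isCompl hQ'
  obtain ⟨e, he, -⟩ := exists_equiv_glue hQ hQ' (LinearEquiv.ofFinrankEq S S' hS)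
    (LinearEquiv.ofFinrankEq Q Q' (by omega))
  refine ⟨e, Submodule.eq_of_le_of_finrank_eq ?_ ?_⟩
  · rintro _ ⟨x, hx, rfl⟩
    have := he ⟨x, hx⟩
    simp only at this
    simp [this]
  · rw [← hS]
    exact LinearEquiv.finrank_map_eq e S

/-- The linear group acts transitively on pairs of subspaces with given dimensions and
intersection. -/
theorem exists_equiv_pair (A B A' B' : PSpace F n) (hA : finrank F A = finrank F A')
    (hB : finrank F B = finrank F B')
    (hI : finrank F (A ⊓ B : PSpace F n) = finrank F (A' ⊓ B' : PSpace F n)) :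
    ∃ e : (Fin n → F) ≃ₗ[F] (Fin n → F),
      A.map (e : (Fin n → F) →ₗ[F] (Fin n → F)) = A' ∧
      B.map (e : (Fin n → F) →ₗ[F] (Fin n → F)) = B' := by
  have key : ∀ A B : PSpace F n, ∃ B₁ Q : PSpace F n, B = (A ⊓ B) ⊔ B₁ ∧ B₁ ≤ Q ∧ IsCompl A Q ∧
      finrank F (A ⊓ B : PSpace F n) + finrank F B₁ = finrank F B := by
    intro A B
    obtain ⟨K, hK⟩ := Submodule.exists_isCompl (A ⊓ B)
    have e1 : B = (A ⊓ B) ⊔ (K ⊓ B) := by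
      rw [← sup_inf_assoc_of_le K (inf_le_right : A ⊓ B ≤ B), hK.sup_eq_top, top_inf_eq]
    have hdis : Disjoint A (K ⊓ B) := by
      rw [disjoint_iff, eq_bot_iff, ← hK.inf_eq_bot]
      exact le_inf (le_inf inf_le_left (inf_le_right.trans inf_le_right))
        (inf_le_right.trans inf_le_left)
    obtain ⟨Q, hQ1, hQ2⟩ := hdis.symm.exists_isCompl
    have h3 := Submodule.finrank_sup_add_finrank_inf_eq (A ⊓ B) (K ⊓ B)
    have h4 : (A ⊓ B) ⊓ (K ⊓ B) = ⊥ := by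
      rw [eq_bot_iff, ← hK.inf_eq_bot]
      exact le_inf inf_le_left (inf_le_right.trans inf_le_left)
    rw [← e1, h4, finrank_bot] at h3
    exact ⟨K ⊓ B, Q, e1, hQ1, hQ2.symm, by omega⟩
  obtain ⟨B₁, Q, hB1, hBQ, hAQ, hf⟩ := key A B
  obtain ⟨B₁', Q', hB1', hBQ', hAQ', hf'⟩ := key A' B'
  have h1 := Submodule.finrank_add_eq_of_isCompl hAQ
  have h2 := Submodule.finrank_add_eq_of_isCompl hAQ'
  have sub : ∀ {S T : PSpace F n}, S ≤ T → finrank F (S.submoduleOf T) = finrank F S :=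
    fun h => (Submodule.submoduleOfEquivOfLe h).finrank_eq
  obtain ⟨e₁, he₁⟩ := exists_equiv_map_eq ((A ⊓ B).submoduleOf A) ((A' ⊓ B').submoduleOf A') hA
    (by rw [sub inf_le_left, sub inf_le_left, hI])
  obtain ⟨e₂, he₂⟩ := exists_equiv_map_eq (B₁.submoduleOf Q) (B₁'.submoduleOf Q') (by omega)
    (by rw [sub hBQ, sub hBQ']; omega)
  obtain ⟨e, hp, hq⟩ := exists_equiv_glue hAQ hAQ' e₁ e₂
  have gen : ∀ {S T S' T' : PSpace F n} (hS : S ≤ T) (f : T ≃ₗ[F] T'),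
      (S.submoduleOf T).map (f : T →ₗ[F] T') = S'.submoduleOf T' → (∀ x : T, e x = f x) →
      finrank F S = finrank F S' → S.map (e : (Fin n → F) →ₗ[F] (Fin n → F)) = S' := by
    intro S T S' T' hS f hf hx hfr
    refine Submodule.eq_of_le_of_finrank_eq ?_ ((LinearEquiv.finrank_map_eq e S).trans hfr)
    rintro _ ⟨x, hxS, rfl⟩
    have h5 : f ⟨x, hS hxS⟩ ∈ S'.submoduleOf T' := by
      rw [← hf]
      exact ⟨⟨x, hS hxS⟩, hxS, rfl⟩
    have h6 := hx ⟨x, hS hxS⟩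
    simp only at h6
    simp only [LinearEquiv.coe_coe, h6]
    exact h5
  have hI' := gen inf_le_left e₁ he₁ hp hI
  have hB' := gen hBQ e₂ he₂ hq (by omega)
  refine ⟨e, ?_, ?_⟩
  · refine Submodule.eq_of_le_of_finrank_eq ?_ ((LinearEquiv.finrank_map_eq e A).trans hA)
    rintro _ ⟨x, hxA, rfl⟩
    have h6 := hp ⟨x, hxA⟩
    simp only at h6
    simp [h6]
  · rw [hB1, Submodule.map_sup, hI', hB', ← hB1']

theorem dS_map (e : (Fin n → F) ≃ₗ[F] (Fin n → F)) (U V : PSpace F n) :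
    dS (U.map (e : (Fin n → F) →ₗ[F] (Fin n → F))) (V.map (e : (Fin n → F) →ₗ[F] (Fin n → F))) =
      dS U V := by
  unfold dS
  rw [← Submodule.map_sup, ← Submodule.map_inf _ e.injective, LinearEquiv.finrank_map_eq,
    LinearEquiv.finrank_map_eq]

/-- The number `N_S(r, s, d)` does not depend on the center. -/
theorem NS_eq (U : PSpace F n) (s d : ℕ) :
    {V : PSpace F n | finrank F V = s ∧ dS U V = d}.ncard = NS F n (finrank F U) s d := by
  have h : ∃ U' : PSpace F n, finrank F U' = finrank F U := ⟨U, rfl⟩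
  rw [NS, dif_pos h]
  have hs := h.choose_spec
  generalize h.choose = U' at hs
  obtain ⟨e, he, -⟩ := exists_equiv_pair U U U' U' hs.symm hs.symm (by rw [inf_idem, inf_idem, hs])
  subst he
  refine Set.ncard_congr (fun V _ => V.map (e : (Fin n → F) →ₗ[F] (Fin n → F))) ?_ ?_ ?_
  · rintro V ⟨h1, h2⟩
    exact ⟨by rw [LinearEquiv.finrank_map_eq, h1], by rw [dS_map, h2]⟩
  · intro V W _ _ hVW
    exact Submodule.map_injective_of_injective e.injective hVW
  · rintro V ⟨h1, h2⟩
    obtain ⟨W, rfl⟩ := Submodule.map_surjective_of_surjective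
      (f := (e : (Fin n → F) →ₗ[F] (Fin n → F))) e.surjective V
    rw [LinearEquiv.finrank_map_eq] at h1
    rw [dS_map] at h2
    exact ⟨W, ⟨h1, h2⟩, rfl⟩

/-- The number `J_S(u, s, w; a, b, c)` does not depend on the centers. -/
theorem JS_eq (A B : PSpace F n) (u s c : ℕ) :
    {X : PSpace F n | finrank F X = c ∧ dS A X = u ∧ dS B X = s}.ncard =
      JS F n u s (dS A B) (finrank F A) (finrank F B) c := by
  have h : ∃ P : PSpace F n × PSpace F n,
      finrank F P.1 = finrank F A ∧ finrank F P.2 = finrank F B ∧ dS P.1 P.2 = dS A B :=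
    ⟨(A, B), rfl, rfl, rfl⟩
  rw [JS, dif_pos h]
  have hs := h.choose_spec
  generalize h.choose = P at hs
  obtain ⟨A', B'⟩ := P
  obtain ⟨h1, h2, h3⟩ := hs
  simp only at h1 h2 h3
  have i1 := Submodule.finrank_sup_add_finrank_inf_eq A B
  have i2 := Submodule.finrank_sup_add_finrank_inf_eq A' B'
  have j1 : finrank F (A ⊓ B : PSpace F n) ≤ finrank F (A ⊔ B : PSpace F n) :=
    Submodule.finrank_mono (inf_le_left.trans le_sup_left)
  have j2 : finrank F (A' ⊓ B' : PSpace F n) ≤ finrank F (A' ⊔ B' : PSpace F n) :=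
    Submodule.finrank_mono (inf_le_left.trans le_sup_left)
  unfold dS at h3
  obtain ⟨e, rfl, rfl⟩ := exists_equiv_pair A B A' B' h1.symm h2.symm (by omega)
  refine Set.ncard_congr (fun V _ => V.map (e : (Fin n → F) →ₗ[F] (Fin n → F))) ?_ ?_ ?_
  · rintro V ⟨k1, k2, k3⟩
    exact ⟨by rw [LinearEquiv.finrank_map_eq, k1], by rw [dS_map, k2], by rw [dS_map, k3]⟩
  · intro V W _ _ hVW
    exact Submodule.map_injective_of_injective e.injective hVW
  · rintro V ⟨k1, k2, k3⟩
    obtain ⟨W, rfl⟩ := Submodule.map_surjective_of_surjective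
      (f := (e : (Fin n → F) →ₗ[F] (Fin n → F))) e.surjective V
    rw [LinearEquiv.finrank_map_eq] at k1
    rw [dS_map] at k2 k3
    exact ⟨W, ⟨k1, k2, k3⟩, rfl⟩

/-! ## Operator channels -/

/-- An operator channel on `E(q, n)`: `W U` is the law of the output if the input is `U`. -/
abbrev OperatorChannel (F : Type*) [Field F] (n : ℕ) : Type _ := PSpace F n → PMF (PSpace F n)

/-- The number of errors (injected dimensions) when `U` is sent and `V` is received. -/
noncomputable def errors (U V : PSpace F n) : ℕ :=
  finrank F V - finrank F (U ⊓ V : PSpace F n)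

/-- The number of erasures (lost dimensions) when `U` is sent and `V` is received. -/
noncomputable def erasures (U V : PSpace F n) : ℕ :=
  finrank F U - finrank F (U ⊓ V : PSpace F n)

/-- A channel is symmetric if, for every input, all outputs corresponding to the same number of
errors and the same number of erasures are equiprobable. -/
def OperatorChannel.IsSymmetric (W : OperatorChannel F n) : Prop :=
  ∀ U V V' : PSpace F n, errors U V = errors U V' → erasures U V = erasures U V' →
    W U V = W U V'

/-! ## The bounded injection distance decoder and its error probability -/

open Classical in
/-- The bounded injection distance decoder with radius `t` for the code `𝒞`: it outputs a codeword
at injection distance at most `t` from the received subspace if there is one, and declares a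
failure (`none`) otherwise. -/
noncomputable def decode (𝒞 : Set (PSpace F n)) (t : ℕ) (V : PSpace F n) : Option (PSpace F n) :=
  if h : ∃ D ∈ 𝒞, dI D V ≤ t then some h.choose else none

/-- The received subspaces for which the decoder outputs a codeword other than the sent `C`. -/
def errorSet (𝒞 : Set (PSpace F n)) (C : PSpace F n) (t : ℕ) : Set (PSpace F n) :=
  {V | ∃ D, decode 𝒞 t V = some D ∧ D ≠ C}

/-- The subspaces of dimension `v` at injection distance `μ` from `C`. -/
def sphere (C : PSpace F n) (μ v : ℕ) : Set (PSpace F n) :=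
  {V | finrank F V = v ∧ dI C V = μ}

/-- The decoder error probability `Π(C, μ, v, t)`: the conditional probability of a decoder error,
given that `C` is sent over the channel `W` and that the received subspace has dimension `v` and is
at injection distance `μ` from `C` (and `0` if the latter event has probability `0`). -/
noncomputable def DEP (W : OperatorChannel F n) (𝒞 : Set (PSpace F n)) (C : PSpace F n)
    (μ v t : ℕ) : ℝ :=
  ((W C).toOuterMeasure (errorSet 𝒞 C t ∩ sphere C μ v)).toReal /
    ((W C).toOuterMeasure (sphere C μ v)).toReal

/-! ## Constants -/

/-- `K_q = ∏_{j ≥ 1} (1 - q ^ (-j))`. -/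
noncomputable def K (q : ℝ) : ℝ := ∏' j : ℕ, (1 - (q ^ (j + 1))⁻¹)

/-- `L_q = K_q ^ (-2) ∑_{i ≥ 0} q ^ (-(3/4) i ^ 2)`. -/
noncomputable def L (q : ℝ) : ℝ := (K q ^ 2)⁻¹ * ∑' i : ℕ, q ^ (-(3 / 4 : ℝ) * (i : ℝ) ^ 2)

end CDC

namespace CDC

open Module Finset

/-! ## Counting subspaces with a prescribed intersection -/

section Counting

variable {F V : Type*} [Field F] [AddCommGroup V] [Module F V]

/-! Given the sent `C`, the pair `(v, μ)` fixes the dimension of the intersection with the received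
space, hence the numbers of errors and erasures. Symmetry therefore makes the output uniform on
`sphere C μ v`, and the error probability is a ratio of cardinalities (`DEP_eq_div`).

Write `δ = |v - r|`. Twice `dI` is `dS` plus the difference of dimensions, so the triangle
inequality for `dS` shows two things. Balls of radius `t` around distinct codewords are disjoint,
and a sphere meets no foreign ball unless `d - t + δ ≤ μ` and `δ ≤ t`. Summing over foreign
codewords, sorted by distance to `C`, gives the exact formula.

For a lifted code all codewords are complements of one subspace `Q` of dimension `n - r`. A
Singleton-type argument then bounds the number of codewords `D` with `D ⊓ C` prescribed. Among all
`r`-dimensional subspaces, those with the same intersection are at least `q ^ ((n - r) * (d - 1))`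
times as many as this bound (`A_mul_pow_le`). So up to this factor the code may be replaced by all
`r`-dimensional subspaces. Double counting pairs `(D, X)` then turns the error count into the size
of the sphere times the volume of a ball of radius `t` around `X`. That volume is a sum over the
dimension of `D ⊓ X`; each term costs two factors `K⁻¹`, and the exponents fall at least like
`-(3/4) j ^ 2`, which produces `L`.

Every count of subspaces rests on `ncard_extensions_mul`. -/

theorem linearIndependent_mkQ_iff {k : ℕ} (X : Submodule F V) (v : Fin k → V) :
    LinearIndependent F (X.mkQ ∘ v) ↔
      LinearIndependent F v ∧ Disjoint (Submodule.span F (Set.range v)) X := by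
  refine ⟨fun h => ⟨h.of_comp X.mkQ, ?_⟩, fun h => h.1.map (by rw [Submodule.ker_mkQ]; exact h.2)⟩
  have := Submodule.range_ker_disjoint h
  rwa [Submodule.ker_mkQ] at this

/-- The `k`-tuples in `Y` that are linearly independent modulo `X`. -/
def indepTuples (X Y : Submodule F V) (k : ℕ) : Set (Fin k → V) :=
  {v | (∀ i, v i ∈ Y) ∧ LinearIndependent F (X.mkQ ∘ v)}

theorem cons_mem_indepTuples_iff {X Y : Submodule F V} {k : ℕ} {x : V} {v : Fin k → V} :
    (Fin.cons x v : Fin (k + 1) → V) ∈ indepTuples X Y (k + 1) ↔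
      v ∈ indepTuples X Y k ∧ x ∈ Y ∧ x ∉ X ⊔ Submodule.span F (Set.range v) := by
  have h1 : X.mkQ ∘ (Fin.cons x v : Fin (k + 1) → V) = Fin.cons (X.mkQ x) (X.mkQ ∘ v) := by
    funext i
    refine Fin.cases ?_ (fun j => ?_) i <;> simp
  have h2 : X.mkQ x ∈ Submodule.span F (Set.range (X.mkQ ∘ v)) ↔
      x ∈ X ⊔ Submodule.span F (Set.range v) := by
    rw [Set.range_comp, ← Submodule.map_span, ← Submodule.mem_comap, Submodule.comap_map_mkQ]
  simp only [indepTuples, Set.mem_ofPred_eq, h1, linearIndependent_finCons, h2, Fin.forall_fin_succ,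
    Fin.cons_zero, Fin.cons_succ]
  tauto

/-- The tuples of length `k + 1` are obtained from those of length `k` by adjoining a vector. -/
def indepTuplesEquiv (X Y : Submodule F V) (k : ℕ) :
    indepTuples X Y (k + 1) ≃ Σ v : indepTuples X Y k,
      ((Y : Set V) \ (X ⊔ Submodule.span F (Set.range v.1) : Submodule F V) : Set V) where
  toFun v :=
    have h := cons_mem_indepTuples_iff.1
      (show (Fin.cons (v.1 0) (Fin.tail v.1) : Fin (k + 1) → V) ∈ _ by
        rw [Fin.cons_self_tail]; exact v.2)
    ⟨⟨Fin.tail v.1, h.1⟩, ⟨v.1 0, h.2⟩⟩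
  invFun p := ⟨Fin.cons p.2.1 p.1.1, cons_mem_indepTuples_iff.2 ⟨p.1.2, p.2.2⟩⟩
  left_inv v := Subtype.ext (Fin.cons_self_tail v.1)
  right_inv p := rfl

variable [FiniteDimensional F V]

theorem finrank_sup_span {X : Submodule F V} {k : ℕ} {v : Fin k → V}
    (h : LinearIndependent F (X.mkQ ∘ v)) :
    finrank F (X ⊔ Submodule.span F (Set.range v) : Submodule F V) = finrank F X + k := by
  obtain ⟨h1, h2⟩ := (linearIndependent_mkQ_iff X v).1 h
  have h3 := Submodule.finrank_sup_add_finrank_inf_eq X (Submodule.span F (Set.range v))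
  rw [h2.symm.eq_bot, finrank_bot, finrank_span_eq_card h1, Fintype.card_fin] at h3
  exact h3

/-- The subspaces `D` of `Y` with `D ⊓ X = S` whose dimension exceeds that of `S` by `k`. -/
def extensions (S X Y : Submodule F V) (k : ℕ) : Set (Submodule F V) :=
  {D | D ≤ Y ∧ D ⊓ X = S ∧ finrank F D = finrank F S + k}

theorem sup_span_mem_extensions {S X Y : Submodule F V} (hS : S ≤ X) (hX : X ≤ Y) {k : ℕ}
    {v : Fin k → V} (hv : v ∈ indepTuples X Y k) :
    S ⊔ Submodule.span F (Set.range v) ∈ extensions S X Y k := by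
  obtain ⟨h1, h2⟩ := hv
  obtain ⟨h3, h4⟩ := (linearIndependent_mkQ_iff X v).1 h2
  refine ⟨sup_le (hS.trans hX) (Submodule.span_le.2 (by rintro _ ⟨i, rfl⟩; exact h1 i)), ?_, ?_⟩
  · rw [sup_inf_assoc_of_le _ hS, h4.eq_bot, sup_bot_eq]
  · exact finrank_sup_span ((linearIndependent_mkQ_iff S v).2 ⟨h3, h4.mono_right hS⟩)

theorem mem_indepTuples_and_sup_span_eq_iff {S X Y D : Submodule F V} {k : ℕ} {v : Fin k → V}
    (hD : D ∈ extensions S X Y k) :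
    v ∈ indepTuples X Y k ∧ S ⊔ Submodule.span F (Set.range v) = D ↔ v ∈ indepTuples S D k := by
  obtain ⟨hDY, rfl, hf⟩ := hD
  constructor
  · rintro ⟨⟨-, h2⟩, h⟩
    obtain ⟨h3, h4⟩ := (linearIndependent_mkQ_iff X v).1 h2
    refine ⟨fun i => ?_, (linearIndependent_mkQ_iff _ v).2 ⟨h3, h4.mono_right inf_le_right⟩⟩
    rw [← h]
    exact Submodule.mem_sup_right (Submodule.subset_span ⟨i, rfl⟩)
  · rintro ⟨h1, h2⟩
    obtain ⟨h3, h4⟩ := (linearIndependent_mkQ_iff _ v).1 h2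
    have hle : Submodule.span F (Set.range v) ≤ D :=
      Submodule.span_le.2 (by rintro _ ⟨i, rfl⟩; exact h1 i)
    refine ⟨⟨fun i => hDY (h1 i), (linearIndependent_mkQ_iff X v).2 ⟨h3, ?_⟩⟩, ?_⟩
    · rw [disjoint_iff, eq_bot_iff, ← h4.eq_bot]
      exact le_inf inf_le_left (le_inf (inf_le_left.trans hle) inf_le_right)
    · exact Submodule.eq_of_le_of_finrank_eq (sup_le inf_le_left hle)
        ((finrank_sup_span h2).trans hf.symm)

variable [Fintype F]

theorem natCard_submodule (X : Submodule F V) : Nat.card X = Fintype.card F ^ finrank F X := by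
  rw [Module.natCard_eq_pow_finrank (K := F), Nat.card_eq_fintype_card]

/-- The next vector must avoid `X` plus the span of the `i` vectors already chosen, a subspace of
`Y` of dimension `finrank F X + i`. -/
theorem ncard_indepTuples {X Y : Submodule F V} (h : X ≤ Y) (k : ℕ) :
    (indepTuples X Y k).ncard =
      ∏ i ∈ range k, (Fintype.card F ^ finrank F Y - Fintype.card F ^ (finrank F X + i)) := by
  have : Finite V := Module.finite_of_finite F
  induction k with
  | zero =>
    rw [prod_range_zero, Set.ncard_eq_one]
    refine ⟨Fin.elim0, Set.eq_singleton_iff_unique_mem.2 ⟨⟨fun i => i.elim0, ?_⟩, ?_⟩⟩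
    · exact linearIndependent_empty_type
    · exact fun v _ => Subsingleton.elim _ _
  | succ k ih =>
    have := Fintype.ofFinite (indepTuples X Y k)
    rw [prod_range_succ, ← ih, ← Nat.card_coe_set_eq, Nat.card_congr (indepTuplesEquiv X Y k),
      Nat.card_sigma, ← Nat.card_coe_set_eq (indepTuples X Y k), Nat.card_eq_fintype_card,
      ← Finset.card_univ, ← smul_eq_mul, ← Finset.sum_const]
    refine Finset.sum_congr rfl fun v _ => ?_
    have hle : ((X ⊔ Submodule.span F (Set.range v.1) : Submodule F V) : Set V) ⊆ Y :=
      sup_le h (Submodule.span_le.2 (by rintro _ ⟨i, rfl⟩; exact v.2.1 i))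
    rw [Nat.card_coe_set_eq, Set.ncard_sdiff hle (Set.toFinite _), ← Nat.card_coe_set_eq,
      ← Nat.card_coe_set_eq]
    change Nat.card Y - Nat.card (X ⊔ Submodule.span F (Set.range v.1) : Submodule F V) = _
    rw [natCard_submodule, natCard_submodule, finrank_sup_span v.2.2]

/-- Adjoining to `S` the span of a tuple independent modulo `X` maps these tuples onto the
extensions. The fibre over `D` consists of the tuples in `D` independent modulo `S`, so all fibres
have the same size. -/
theorem ncard_extensions_mul {S X Y : Submodule F V} (hS : S ≤ X) (hX : X ≤ Y) (k : ℕ) :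
    (extensions S X Y k).ncard *
      ∏ i ∈ range k,
        (Fintype.card F ^ (finrank F S + k) - Fintype.card F ^ (finrank F S + i)) =
      ∏ i ∈ range k, (Fintype.card F ^ finrank F Y - Fintype.card F ^ (finrank F X + i)) := by
  classical
  have : Finite V := Module.finite_of_finite F
  rw [← ncard_indepTuples hX k, Set.ncard_eq_toFinset_card (indepTuples X Y k),
    Set.ncard_eq_toFinset_card (extensions S X Y k),
    Finset.card_eq_sum_card_fiberwise (t := (Set.toFinite (extensions S X Y k)).toFinset)
      (f := fun v => S ⊔ Submodule.span F (Set.range v)), ← smul_eq_mul, ← Finset.sum_const]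
  · refine Finset.sum_congr rfl fun D hD => ?_
    rw [Set.Finite.mem_toFinset] at hD
    have hSD : S ≤ D := hD.2.1 ▸ inf_le_left
    rw [← hD.2.2, ← ncard_indepTuples hSD k, Set.ncard_eq_toFinset_card]
    congr 1
    ext v
    simp only [Set.Finite.mem_toFinset, Finset.mem_filter]
    exact (mem_indepTuples_and_sup_span_eq_iff hD).symm
  · intro v hv
    simp only [Set.Finite.coe_toFinset] at hv ⊢
    exact sup_span_mem_extensions hS hX hv

end Counting

end CDC

namespace CDC

open Module Finset

/-! ## The constants `K` and `L` -/

section Constants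

theorem summable_inv_pow_succ {q : ℝ} (hq : 1 < q) : Summable fun j : ℕ => (q ^ (j + 1))⁻¹ := by
  have h : Summable fun j : ℕ => (q⁻¹) ^ j :=
    summable_geometric_of_lt_one (by positivity) (inv_lt_one_of_one_lt₀ hq)
  simpa [inv_pow] using (summable_nat_add_iff 1).2 h

theorem one_sub_inv_pow_succ_pos {q : ℝ} (hq : 1 < q) (j : ℕ) : 0 < 1 - (q ^ (j + 1))⁻¹ :=
  sub_pos.2 (inv_lt_one_of_one_lt₀ (one_lt_pow₀ hq j.succ_ne_zero))

theorem summable_log_one_sub_inv_pow {q : ℝ} (hq : 1 < q) :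
    Summable fun j : ℕ => Real.log (1 - (q ^ (j + 1))⁻¹) := by
  simpa [sub_eq_add_neg] using
    Real.summable_log_one_add_of_summable (summable_inv_pow_succ hq).neg

theorem K_pos {q : ℝ} (hq : 1 < q) : 0 < K q := by
  rw [K, ← Real.rexp_tsum_eq_tprod (one_sub_inv_pow_succ_pos hq) (summable_log_one_sub_inv_pow hq)]
  exact Real.exp_pos _

/-- The factors lie in `(0, 1)`, so the partial products decrease to their limit `K q`. -/
theorem K_le_prod {q : ℝ} (hq : 1 < q) (k : ℕ) :
    K q ≤ ∏ j ∈ range k, (1 - (q ^ (j + 1))⁻¹) := by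
  have h : Multipliable fun j : ℕ => 1 - (q ^ (j + 1))⁻¹ :=
    Real.multipliable_of_summable_log (one_sub_inv_pow_succ_pos hq)
      (summable_log_one_sub_inv_pow hq)
  refine Antitone.le_of_tendsto (f := fun k => ∏ j ∈ range k, (1 - (q ^ (j + 1))⁻¹))
    (antitone_nat_of_succ_le fun m => ?_) h.hasProd.tendsto_prod_nat k
  rw [prod_range_succ]
  refine mul_le_of_le_one_right (prod_nonneg fun j _ => (one_sub_inv_pow_succ_pos hq j).le) ?_
  have : 0 ≤ (q ^ (m + 1))⁻¹ := by positivity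
  linarith

theorem summable_rpow_neg_sq {q : ℝ} (hq : 1 < q) :
    Summable fun i : ℕ => q ^ (-(3 / 4 : ℝ) * (i : ℝ) ^ 2) := by
  have hq0 : 0 < q := by linarith
  have hlt : q ^ (-(3 / 4 : ℝ)) < 1 := Real.rpow_lt_one_of_one_lt_of_neg hq (by norm_num)
  refine Summable.of_nonneg_of_le (fun i => by positivity) (fun i => ?_)
    (summable_geometric_of_lt_one (by positivity) hlt)
  rw [← Real.rpow_natCast (q ^ (-(3 / 4 : ℝ))) i, ← Real.rpow_mul hq0.le]
  refine Real.rpow_le_rpow_of_exponent_le hq.le ?_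
  have : (i : ℝ) ≤ (i : ℝ) ^ 2 := by exact_mod_cast Nat.le_self_pow two_ne_zero i
  linarith

/-- The source of strictness in the final bound: the omitted term of index `m` is positive. -/
theorem sum_lt_tsum_rpow_neg_sq {q : ℝ} (hq : 1 < q) (m : ℕ) :
    ∑ i ∈ range m, q ^ (-(3 / 4 : ℝ) * (i : ℝ) ^ 2) <
      ∑' i : ℕ, q ^ (-(3 / 4 : ℝ) * (i : ℝ) ^ 2) := by
  have hq0 : 0 < q := by linarith
  refine lt_of_lt_of_le ?_ ((summable_rpow_neg_sq hq).sum_le_tsum (range (m + 1))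
    fun i _ => by positivity)
  rw [sum_range_succ]
  exact lt_add_of_pos_right _ (by positivity)

theorem L_pos {q : ℝ} (hq : 1 < q) : 0 < L q := by
  have := sum_lt_tsum_rpow_neg_sq hq 0
  rw [sum_range_zero] at this
  have := K_pos hq
  unfold L
  positivity

end Constants

/-! ## Bounds on the number of subspaces with a prescribed intersection -/

section Bounds

variable {F V : Type*} [Field F] [AddCommGroup V] [Module F V] [FiniteDimensional F V] [Fintype F]

theorem one_lt_card_real (F : Type*) [Field F] [Fintype F] : (1 : ℝ) < Fintype.card F := by
  exact_mod_cast Fintype.one_lt_card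

theorem prod_pow_sub_pow {q : ℝ} (hq : 1 < q) (s k : ℕ) :
    ∏ i ∈ range k, (q ^ (s + k) - q ^ (s + i)) =
      (q ^ (s + k)) ^ k * ∏ j ∈ range k, (1 - (q ^ (j + 1))⁻¹) := by
  have hq0 : q ≠ 0 := by linarith
  rw [← prod_range_reflect (fun j => 1 - (q ^ (j + 1))⁻¹) k]
  rw [pow_eq_prod_const (q ^ (s + k)) k, ← prod_mul_distrib]
  refine prod_congr rfl fun i hi => ?_
  obtain ⟨c, rfl⟩ := Nat.exists_eq_add_of_lt (mem_range.1 hi)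
  rw [show i + c + 1 - 1 - i + 1 = c + 1 by omega]
  field_simp
  ring

/-- In the quotient of products, each factor of the numerator is at most `q ^ finrank F Y`, and the
denominator is a power of `q` times a partial product of `K`. -/
theorem ncard_extensions_le {S X Y : Submodule F V} (hS : S ≤ X) (hX : X ≤ Y) {k m : ℕ}
    (hm : finrank F Y = finrank F S + k + m) :
    ((extensions S X Y k).ncard : ℝ) ≤
      (K (Fintype.card F))⁻¹ * (Fintype.card F : ℝ) ^ (m * k) := by
  have hq := one_lt_card_real F
  have hqN : 0 < Fintype.card F := Fintype.card_pos
  have h := congrArg (Nat.cast (R := ℝ)) (ncard_extensions_mul hS hX k)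
  set G := (extensions S X Y k).ncard
  push_cast at h
  have h1 : ∏ i ∈ range k, (((Fintype.card F ^ (finrank F S + k) -
      Fintype.card F ^ (finrank F S + i) : ℕ)) : ℝ) =
      ∏ i ∈ range k, ((Fintype.card F : ℝ) ^ (finrank F S + k) -
        (Fintype.card F : ℝ) ^ (finrank F S + i)) := by
    refine prod_congr rfl fun i hi => ?_
    rw [Nat.cast_sub (Nat.pow_le_pow_right hqN (by have := mem_range.1 hi; omega))]
    push_cast
    rfl
  have h2 : ∏ i ∈ range k, (((Fintype.card F ^ finrank F Y -
      Fintype.card F ^ (finrank F X + i) : ℕ)) : ℝ) ≤ ((Fintype.card F : ℝ) ^ finrank F Y) ^ k := by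
    rw [pow_eq_prod_const ((Fintype.card F : ℝ) ^ finrank F Y) k]
    refine prod_le_prod (fun i _ => Nat.cast_nonneg _) fun i _ => ?_
    exact_mod_cast Nat.sub_le _ _
  rw [h1, prod_pow_sub_pow hq] at h
  set q : ℝ := (Fintype.card F : ℝ)
  have hq0 : 0 < q := by linarith
  rw [← h, hm, pow_add _ _ m, mul_pow, mul_left_comm] at h2
  have h3 := le_of_mul_le_mul_left h2 (by positivity)
  rw [← pow_mul] at h3
  have h4 : (G : ℝ) * K q ≤ q ^ (m * k) :=
    (mul_le_mul_of_nonneg_left (K_le_prod hq k) (by positivity)).trans h3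
  rw [inv_mul_eq_div, le_div_iff₀ (K_pos hq)]
  exact h4

theorem prod_pow_sub_pow_pos (F : Type*) [Field F] [Fintype F] (s k : ℕ) :
    0 < ∏ i ∈ range k, (Fintype.card F ^ (s + k) - Fintype.card F ^ (s + i)) :=
  prod_pos fun i hi => Nat.sub_pos_of_lt
    (Nat.pow_lt_pow_right Fintype.one_lt_card (by have := mem_range.1 hi; omega))

/-- A factorwise comparison: `q ^ m` times the `i`-th factor of the denominator is `q ^ finrank F Y
- q ^ (finrank F S + m + i)`. The hypothesis `hx` decides on which side of the numerator's factor
this lies; in the equality case the count is exactly `q ^ (m * k)`. -/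
theorem pow_le_ncard_extensions {S X Y : Submodule F V} (hS : S ≤ X) (hX : X ≤ Y) {k m : ℕ}
    (hm : finrank F Y = finrank F S + k + m) (hx : finrank F X ≤ finrank F S + m) :
    Fintype.card F ^ (m * k) ≤ (extensions S X Y k).ncard := by
  refine Nat.le_of_mul_le_mul_right ?_ (prod_pow_sub_pow_pos F (finrank F S) k)
  rw [ncard_extensions_mul hS hX, pow_mul]
  rw [pow_eq_prod_const (Fintype.card F ^ m) k, ← prod_mul_distrib]
  refine prod_le_prod' fun i hi => ?_
  rw [Nat.mul_sub, ← pow_add, ← pow_add, hm]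
  have h1 : Fintype.card F ^ (finrank F X + i) ≤ Fintype.card F ^ (m + (finrank F S + i)) :=
    Nat.pow_le_pow_right Fintype.card_pos (by omega)
  rw [add_comm m (finrank F S + k)]
  exact Nat.sub_le_sub_left h1 _

theorem ncard_extensions_le_pow {S X Y : Submodule F V} (hS : S ≤ X) (hX : X ≤ Y) {k m : ℕ}
    (hm : finrank F Y = finrank F S + k + m) (hx : finrank F S + m ≤ finrank F X) :
    (extensions S X Y k).ncard ≤ Fintype.card F ^ (m * k) := by
  refine Nat.le_of_mul_le_mul_right ?_ (prod_pow_sub_pow_pos F (finrank F S) k)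
  rw [ncard_extensions_mul hS hX, pow_mul]
  rw [pow_eq_prod_const (Fintype.card F ^ m) k, ← prod_mul_distrib]
  refine prod_le_prod' fun i hi => ?_
  rw [Nat.mul_sub, ← pow_add, ← pow_add, hm]
  have h1 : Fintype.card F ^ (m + (finrank F S + i)) ≤ Fintype.card F ^ (finrank F X + i) :=
    Nat.pow_le_pow_right Fintype.card_pos (by omega)
  rw [add_comm m (finrank F S + k)]
  exact Nat.sub_le_sub_left h1 _

end Bounds

end CDC

namespace CDC

open Module Finset

/-! ## The subspace distance and the injection distance -/

section Distances

variable {F : Type*} [Field F] {n : ℕ}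

/-- Allows every argument on `dI` to use the triangle inequality of `dS`, with the difference of
dimensions as an exact correction. -/
theorem two_mul_dI (U V : PSpace F n) :
    2 * dI U V = dS U V + (max (finrank F U) (finrank F V) - min (finrank F U) (finrank F V)) := by
  have h1 := Submodule.finrank_sup_add_finrank_inf_eq U V
  have h2 : finrank F (U ⊓ V : PSpace F n) ≤ finrank F U := Submodule.finrank_mono inf_le_left
  have h3 : finrank F (U ⊓ V : PSpace F n) ≤ finrank F V := Submodule.finrank_mono inf_le_right
  unfold dI dS
  omega

theorem dI_add_finrank_inf (U V : PSpace F n) :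
    dI U V + finrank F (U ⊓ V : PSpace F n) = max (finrank F U) (finrank F V) := by
  have h2 : finrank F (U ⊓ V : PSpace F n) ≤ finrank F U := Submodule.finrank_mono inf_le_left
  unfold dI
  omega

theorem max_sub_min_le_dI (U V : PSpace F n) :
    max (finrank F U) (finrank F V) - min (finrank F U) (finrank F V) ≤ dI U V := by
  have h2 : finrank F (U ⊓ V : PSpace F n) ≤ finrank F U := Submodule.finrank_mono inf_le_left
  have h3 : finrank F (U ⊓ V : PSpace F n) ≤ finrank F V := Submodule.finrank_mono inf_le_right
  unfold dI
  omega

theorem dI_comm (U V : PSpace F n) : dI U V = dI V U := by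
  unfold dI
  rw [max_comm, inf_comm]

theorem dI_self (U : PSpace F n) : dI U U = 0 := by
  unfold dI
  rw [max_self, inf_idem, Nat.sub_self]

/-- Since `U ⊓ X` and `X ⊓ V` both lie in `X`, the dimension formula bounds their common part, which
lies in `U ⊓ V`, from below. -/
theorem dS_triangle (U V X : PSpace F n) : dS U V ≤ dS U X + dS X V := by
  have h1 := Submodule.finrank_sup_add_finrank_inf_eq U V
  have h2 := Submodule.finrank_sup_add_finrank_inf_eq U X
  have h3 := Submodule.finrank_sup_add_finrank_inf_eq X V
  have h4 := Submodule.finrank_sup_add_finrank_inf_eq (U ⊓ X) (X ⊓ V)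
  have h5 : finrank F ((U ⊓ X) ⊔ (X ⊓ V) : PSpace F n) ≤ finrank F X :=
    Submodule.finrank_mono (sup_le inf_le_right inf_le_left)
  have h6 : finrank F ((U ⊓ X) ⊓ (X ⊓ V) : PSpace F n) ≤ finrank F (U ⊓ V : PSpace F n) :=
    Submodule.finrank_mono (le_inf (inf_le_left.trans inf_le_left)
      (inf_le_right.trans inf_le_right))
  have h7 : finrank F (U ⊓ X : PSpace F n) ≤ finrank F U := Submodule.finrank_mono inf_le_left
  have h8 : finrank F (X ⊓ V : PSpace F n) ≤ finrank F V := Submodule.finrank_mono inf_le_right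
  unfold dS
  omega

theorem dI_le_of_finrank_eq {U V : PSpace F n} (h : finrank F U = finrank F V) :
    dI U V ≤ finrank F V := by
  unfold dI
  omega

theorem finrank_inf_eq_of_dI {C D : PSpace F n} {r : ℕ} (hC : finrank F C = r) (hD : finrank F D = r) :
    finrank F (D ⊓ C : PSpace F n) = r - dI D C := by
  have := dI_add_finrank_inf D C
  rw [hC, hD] at this
  omega

end Distances

/-! ## The decoder error probability as a ratio of numbers of subspaces -/

section Channel

variable {F : Type*} [Field F] {n : ℕ}

/-- On a sphere the dimension of `C ⊓ V` is constantly `max (finrank F C) v - μ`, so errors and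
erasures are constant too. -/
theorem OperatorChannel.IsSymmetric.apply_eq_of_mem_sphere {W : OperatorChannel F n}
    (hW : W.IsSymmetric) {C V V' : PSpace F n} {μ v : ℕ} (hV : V ∈ sphere C μ v)
    (hV' : V' ∈ sphere C μ v) : W C V = W C V' := by
  obtain ⟨h1, h2⟩ := hV
  obtain ⟨h3, h4⟩ := hV'
  have h5 := dI_add_finrank_inf C V
  have h6 := dI_add_finrank_inf C V'
  apply hW <;> simp only [errors, erasures] <;> omega

theorem _root_.PMF.toOuterMeasure_eq_ncard_mul {α : Type*} [Finite α] (p : PMF α) {s : Set α}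
    {c : ENNReal} (h : ∀ x ∈ s, p x = c) : p.toOuterMeasure s = s.ncard * c := by
  obtain ⟨u, rfl⟩ := (Set.toFinite s).exists_finset_coe
  rw [PMF.toOuterMeasure_apply_finset, Finset.sum_congr rfl h, Finset.sum_const, nsmul_eq_mul,
    Set.ncard_coe_finset]

theorem DEP_eq_div [Fintype F] {W : OperatorChannel F n} (hW : W.IsSymmetric)
    (𝒞 : Set (PSpace F n)) {C : PSpace F n} {μ v : ℕ} (t : ℕ)
    (h : (W C).toOuterMeasure (sphere C μ v) ≠ 0) :
    DEP W 𝒞 C μ v t = ((errorSet 𝒞 C t ∩ sphere C μ v).ncard : ℝ) / (sphere C μ v).ncard := by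
  have hne : (sphere C μ v).Nonempty := by
    rw [Set.nonempty_iff_ne_empty]
    intro h'
    exact h (by rw [h', MeasureTheory.measure_empty])
  obtain ⟨V, hV⟩ := hne
  have h1 : ∀ X ∈ sphere C μ v, W C X = W C V := fun X hX => hW.apply_eq_of_mem_sphere hX hV
  rw [DEP, (W C).toOuterMeasure_eq_ncard_mul h1,
    (W C).toOuterMeasure_eq_ncard_mul fun X hX => h1 X (Set.inter_subset_right hX)]
  rw [(W C).toOuterMeasure_eq_ncard_mul h1] at h
  -- The common mass of the points of the sphere is nonzero because the sphere has positive
  -- probability, so it cancels from the quotient.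
  have h2 : (W C V).toReal ≠ 0 :=
    ENNReal.toReal_ne_zero.2 ⟨right_ne_zero_of_mul h, (W C).apply_ne_top V⟩
  rw [ENNReal.toReal_mul, ENNReal.toReal_mul, mul_div_mul_right _ _ h2, ENNReal.toReal_natCast,
    ENNReal.toReal_natCast]

theorem DEP_eq_zero_of_measure_sphere_eq_zero {W : OperatorChannel F n} (𝒞 : Set (PSpace F n))
    {C : PSpace F n} {μ v : ℕ} (t : ℕ) (h : (W C).toOuterMeasure (sphere C μ v) = 0) :
    DEP W 𝒞 C μ v t = 0 := by
  rw [DEP, h, ENNReal.toReal_zero, div_zero]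

end Channel

/-! ## Decoding errors -/

section Errors

variable {F : Type*} [Field F] {n : ℕ}

/-- The number of subspaces of dimension `v` at injection distance `μ` from `C` and at injection
distance at most `t` from `D`. -/
noncomputable def nearCount (C D : PSpace F n) (μ v t : ℕ) : ℕ :=
  {X : PSpace F n | X ∈ sphere C μ v ∧ dI D X ≤ t}.ncard

theorem exists_of_mem_errorSet {𝒞 : Set (PSpace F n)} {C V : PSpace F n} {t : ℕ}
    (h : V ∈ errorSet 𝒞 C t) : ∃ D ∈ 𝒞, D ≠ C ∧ dI D V ≤ t := by
  obtain ⟨D, h1, h2⟩ := h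
  unfold decode at h1
  split_ifs at h1 with h3
  have h4 := h3.choose_spec
  rw [Option.some.inj h1] at h4
  exact ⟨D, h4.1, h2, h4.2⟩

/-- The decoder's choice within radius `t` is arbitrary, but it cannot be `C`, which is too far
away. -/
theorem mem_errorSet_iff {𝒞 : Set (PSpace F n)} {C V : PSpace F n} {t : ℕ} (hC : t < dI C V) :
    V ∈ errorSet 𝒞 C t ↔ ∃ D ∈ 𝒞, D ≠ C ∧ dI D V ≤ t := by
  refine ⟨exists_of_mem_errorSet, ?_⟩
  rintro ⟨D, h1, -, h2⟩
  have h : ∃ D ∈ 𝒞, dI D V ≤ t := ⟨D, h1, h2⟩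
  refine ⟨h.choose, by rw [decode, dif_pos h], fun h' => ?_⟩
  have := h.choose_spec.2
  rw [h'] at this
  omega

variable {r d t v μ δ : ℕ} {𝒞 : Set (PSpace F n)} {C : PSpace F n}

/-- If `V` is decoded to some `D ≠ C`, then `2 * d ≤ dS D C ≤ (2 * t - δ) + (2 * μ - δ)` and `δ ≤ dI
D V ≤ t`, which forces both excluded inequalities. -/
theorem not_mem_errorSet_of_mem_sphere (hdim : ∀ U ∈ 𝒞, finrank F U = r)
    (hd : ∀ U ∈ 𝒞, ∀ V ∈ 𝒞, U ≠ V → d ≤ dI U V) (htd : t ≤ d) (hC : C ∈ 𝒞)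
    (hδ : δ = max r v - min r v) (h : ¬(d - t + δ ≤ μ ∧ δ ≤ t)) :
    errorSet 𝒞 C t ∩ sphere C μ v = ∅ := by
  rw [Set.eq_empty_iff_forall_notMem]
  rintro V ⟨h1, h2, h3⟩
  obtain ⟨D, hD, hne, hDV⟩ := exists_of_mem_errorSet h1
  have e1 := hdim C hC
  have e2 := hdim D hD
  have h4 := hd D hD C hC hne
  have h5 := two_mul_dI D C
  have h6 := two_mul_dI D V
  have h7 := two_mul_dI C V
  have h8 := dS_triangle D C V
  have h9 : dS V C = dS C V := by unfold dS; rw [sup_comm, inf_comm]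
  have h10 := max_sub_min_le_dI D V
  rw [e1, e2] at h5
  rw [e2, h2] at h6 h10
  rw [e1, h2] at h7
  omega

/-- Sort the counted subspaces `X` by `s = dS D X`: as `2 * dI D X = s + δ`, being within `t` of `D`
means `s ≤ 2 * t - δ`. -/
theorem nearCount_eq_sum_JS [Fintype F] {D : PSpace F n} (hC : finrank F C = r)
    (hD : finrank F D = r) (hδ : δ = max r v - min r v) (hμ : δ ≤ μ) (ht : δ ≤ t) :
    nearCount C D μ v t =
      ∑ s ∈ range (2 * t - δ + 1), JS F n (2 * μ - δ) s (2 * dI D C) r r v := by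
  classical
  have h0 : 2 * dI D C = dS C D := by
    have := two_mul_dI C D
    rw [hC, hD] at this
    rw [dI_comm]
    omega
  rw [nearCount, h0, Set.ncard_eq_toFinset_card,
    Finset.card_eq_sum_card_fiberwise (f := dS D) (t := range (2 * t - δ + 1))]
  · refine Finset.sum_congr rfl fun s hs => ?_
    rw [← congr (congrArg (JS F n (2 * μ - δ) s (dS C D)) hC) hD, ← JS_eq C D,
      ← Set.ncard_coe_finset]
    congr 1
    ext X
    simp only [Finset.coe_filter, Set.Finite.mem_toFinset, Set.mem_ofPred_eq, sphere]
    have h1 := two_mul_dI C X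
    have h2 := two_mul_dI D X
    rw [hC] at h1
    rw [hD] at h2
    have hs' := mem_range.1 hs
    constructor
    · rintro ⟨⟨⟨a1, a2⟩, a3⟩, a4⟩
      subst a1
      exact ⟨rfl, by omega, a4⟩
    · rintro ⟨a1, a2, a3⟩
      subst a1
      exact ⟨⟨⟨rfl, by omega⟩, by omega⟩, a3⟩
  · intro X hX
    simp only [Set.Finite.coe_toFinset, Set.mem_ofPred_eq, sphere] at hX
    obtain ⟨⟨a1, a2⟩, a3⟩ := hX
    have h2 := two_mul_dI D X
    rw [hD, a1] at h2
    simp only [Finset.coe_range, Set.mem_Iio]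
    omega

theorem ncard_sphere (hC : finrank F C = r) [Fintype F] (hδ : δ = max r v - min r v)
    (hμ : δ ≤ μ) : (sphere C μ v).ncard = NS F n r v (2 * μ - δ) := by
  rw [← hC, ← NS_eq]
  congr 1
  ext X
  simp only [Set.mem_ofPred_eq, sphere]
  have h1 := two_mul_dI C X
  rw [hC] at h1
  constructor
  · rintro ⟨rfl, h⟩
    exact ⟨rfl, by omega⟩
  · rintro ⟨rfl, h⟩
    exact ⟨rfl, by omega⟩

theorem ncard_errorSet_inter_sphere [Fintype F] (hdim : ∀ U ∈ 𝒞, finrank F U = r)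
    (hd : ∀ U ∈ 𝒞, ∀ V ∈ 𝒞, U ≠ V → d ≤ dI U V) (htd : 2 * t < d) (hC : C ∈ 𝒞)
    (hδ : δ = max r v - min r v) (hμ : d - t + δ ≤ μ) (ht : δ ≤ t) :
    (errorSet 𝒞 C t ∩ sphere C μ v).ncard =
      ∑ w ∈ Icc d r, A 𝒞 C w *
        ∑ s ∈ range (2 * t - δ + 1), JS F n (2 * μ - δ) s (2 * w) r r v := by
  classical
  have hfin : ({D | D ∈ 𝒞 ∧ D ≠ C} : Set (PSpace F n)).Finite := Set.toFinite _
  have h1 : errorSet 𝒞 C t ∩ sphere C μ v =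
      ⋃ D ∈ {D | D ∈ 𝒞 ∧ D ≠ C}, {X : PSpace F n | X ∈ sphere C μ v ∧ dI D X ≤ t} := by
    ext X
    simp only [Set.mem_inter_iff, Set.mem_iUnion, Set.mem_ofPred_eq, exists_prop]
    constructor
    · rintro ⟨a1, a2⟩
      obtain ⟨D, b1, b2, b3⟩ := exists_of_mem_errorSet a1
      exact ⟨D, ⟨b1, b2⟩, a2, b3⟩
    · rintro ⟨D, ⟨b1, b2⟩, a2, b3⟩
      -- Since `2 * t < d`, the bound `d - t + δ ≤ μ` gives `t < μ`, so `C` is out of the decoder's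
      -- reach.
      refine ⟨(mem_errorSet_iff ?_).2 ⟨D, b1, b2, b3⟩, a2⟩
      have := a2.2
      omega
  -- A common point of two balls would give `2 * d ≤ dS D D' ≤ 2 * (2 * t - δ)`, contrary to `2 * t
  -- < d`.
  have h2 : ({D | D ∈ 𝒞 ∧ D ≠ C} : Set (PSpace F n)).PairwiseDisjoint
      fun D => {X : PSpace F n | X ∈ sphere C μ v ∧ dI D X ≤ t} := by
    intro D hD D' hD' hne
    rw [Function.onFun, Set.disjoint_left]
    rintro X ⟨-, a1⟩ ⟨-, a2⟩
    have e1 := hdim D hD.1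
    have e2 := hdim D' hD'.1
    have h4 := hd D hD.1 D' hD'.1 hne
    have h5 := two_mul_dI D D'
    have h6 := two_mul_dI D X
    have h7 := two_mul_dI D' X
    have h8 := dS_triangle D D' X
    have h9 : dS X D' = dS D' X := by unfold dS; rw [sup_comm, inf_comm]
    rw [e1, e2] at h5
    rw [e1] at h6
    rw [e2] at h7
    omega
  rw [h1, Set.ncard_eq_toFinset_card]
  have h3 : (Set.toFinite (⋃ D ∈ {D | D ∈ 𝒞 ∧ D ≠ C},
      {X : PSpace F n | X ∈ sphere C μ v ∧ dI D X ≤ t})).toFinset =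
      hfin.toFinset.biUnion fun D =>
        (Set.toFinite {X : PSpace F n | X ∈ sphere C μ v ∧ dI D X ≤ t}).toFinset := by
    ext X
    simp only [Set.Finite.mem_toFinset, Set.mem_iUnion, Finset.mem_biUnion, exists_prop]
  rw [h3, Finset.card_biUnion]
  · have h4 : ∀ D ∈ hfin.toFinset, dI D C ∈ Icc d r := by
      intro D hD
      obtain ⟨b1, b2⟩ := hfin.mem_toFinset.1 hD
      refine mem_Icc.2 ⟨hd D b1 C hC b2, ?_⟩
      rw [← hdim C hC]
      exact dI_le_of_finrank_eq (by rw [hdim D b1, hdim C hC])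
    rw [← Finset.sum_fiberwise_of_maps_to h4]
    refine Finset.sum_congr rfl fun w hw => ?_
    have h5 : A 𝒞 C w = #{D ∈ hfin.toFinset | dI D C = w} := by
      rw [A, ← Set.ncard_coe_finset]
      congr 1
      ext D
      simp only [Finset.coe_filter, Set.Finite.mem_toFinset, Set.mem_ofPred_eq]
      constructor
      · rintro ⟨a1, a2⟩
        refine ⟨⟨a1, ?_⟩, a2⟩
        rintro rfl
        rw [dI_self] at a2
        have := mem_Icc.1 hw
        omega
      · exact fun a => ⟨a.1.1, a.2⟩
    rw [h5, ← smul_eq_mul, ← Finset.sum_const]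
    refine Finset.sum_congr rfl fun D hD => ?_
    obtain ⟨hD', rfl⟩ := Finset.mem_filter.1 hD
    rw [← nearCount_eq_sum_JS (hdim C hC) (hdim D (hfin.mem_toFinset.1 hD').1) hδ (by omega) ht,
      nearCount, Set.ncard_eq_toFinset_card]
  · intro D hD D' hD' hne
    rw [Function.onFun, Set.Finite.disjoint_toFinset]
    exact h2 (hfin.mem_toFinset.1 hD) (hfin.mem_toFinset.1 hD') hne

end Errors

end CDC

namespace CDC

open Module Finset

theorem ncard_eq_sum_fiberwise {α β : Type*} [Finite α] (s : Set α) (f : α → β)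
    (t : Finset β) (h : ∀ a ∈ s, f a ∈ t) :
    s.ncard = ∑ b ∈ t, {a | a ∈ s ∧ f a = b}.ncard := by
  classical
  rw [Set.ncard_eq_toFinset_card s,
    Finset.card_eq_sum_card_fiberwise (f := f) (t := t) (by simpa [Set.MapsTo] using h)]
  refine Finset.sum_congr rfl fun b _ => ?_
  rw [← Set.ncard_coe_finset]
  congr 1
  ext a
  simp

/-! ## Liftings -/

section Lifting

variable {F : Type*} [Field F] {n r : ℕ}

/-- The projection of `F ^ n` onto the first `r` coordinates. -/
def firstCoords (F : Type*) [Field F] (hr : r ≤ n) : (Fin n → F) →ₗ[F] (Fin r → F) :=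
  LinearMap.funLeft F F (Fin.castLE hr)

theorem lift_eq_range (hr : r ≤ n) (M : Matrix (Fin r) (Fin (n - r)) F) :
    lift hr M = LinearMap.range (idAugment hr M).vecMulLinear := by
  rw [lift, range_vecMulLinear]

theorem idAugment_apply_castLE (hr : r ≤ n) (M : Matrix (Fin r) (Fin (n - r)) F) (i j : Fin r) :
    idAugment hr M i (Fin.castLE hr j) = (1 : Matrix (Fin r) (Fin r) F) i j := by
  have h : Fin.cast (Nat.add_sub_of_le hr).symm (Fin.castLE hr j) = Fin.castAdd (n - r) j := rfl
  simp [idAugment, h]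

theorem firstCoords_vecMul (hr : r ≤ n) (M : Matrix (Fin r) (Fin (n - r)) F) (x : Fin r → F) :
    firstCoords F hr ((idAugment hr M).vecMulLinear x) = x := by
  funext j
  have : (Matrix.vecMul x (idAugment hr M)) (Fin.castLE hr j) =
      Matrix.vecMul x (1 : Matrix (Fin r) (Fin r) F) j := by
    simp only [Matrix.vecMul, dotProduct, idAugment_apply_castLE]
  simpa [firstCoords, LinearMap.funLeft_apply] using this

/-- A common complement of all codewords is the only feature of a lifted code that the upper bound
uses. -/
theorem isCompl_lift_ker_firstCoords (hr : r ≤ n) (M : Matrix (Fin r) (Fin (n - r)) F) :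
    IsCompl (lift hr M) (LinearMap.ker (firstCoords F hr)) := by
  rw [lift_eq_range]
  constructor
  · rw [Submodule.disjoint_def]
    rintro _ ⟨x, rfl⟩ hx
    rw [LinearMap.mem_ker, firstCoords_vecMul] at hx
    rw [hx, map_zero]
  · rw [codisjoint_iff, Submodule.eq_top_iff']
    intro x
    rw [← add_sub_cancel ((idAugment hr M).vecMulLinear (firstCoords F hr x)) x]
    exact Submodule.add_mem_sup ⟨_, rfl⟩
      (by rw [LinearMap.mem_ker, map_sub, firstCoords_vecMul, sub_self])

end Lifting

/-! ## Distance distribution of codes consisting of complements of a subspace -/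

section Distribution

variable {F : Type*} [Field F] [Fintype F] {n r d w : ℕ} {𝒞 : Set (PSpace F n)} {C Q : PSpace F n}

theorem exists_between_finrank_eq {S T : PSpace F n} (h : S ≤ T) {k : ℕ} (h1 : finrank F S ≤ k)
    (h2 : k ≤ finrank F T) : ∃ R : PSpace F n, S ≤ R ∧ R ≤ T ∧ finrank F R = k := by
  have h3 : 0 < (extensions S S T (k - finrank F S)).ncard :=
    lt_of_lt_of_le (pow_pos Fintype.card_pos _) (pow_le_ncard_extensions le_rfl h
      (m := finrank F T - k) (by omega) (by omega))
  obtain ⟨R, a1, a2, a3⟩ := Set.nonempty_of_ncard_ne_zero h3.ne'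
  exact ⟨R, a2 ▸ inf_le_left, a1, by omega⟩

/-- A Singleton bound for codewords through a given subspace. -/
theorem ncard_codewords_ge_le (hdim : ∀ U ∈ 𝒞, finrank F U = r) (hQ : ∀ U ∈ 𝒞, IsCompl U Q)
    (hd : ∀ U ∈ 𝒞, ∀ V ∈ 𝒞, U ≠ V → d ≤ dI U V) (hC : C ∈ 𝒞) (hd0 : 0 < d) (hdw : d ≤ w)
    (hwr : w ≤ r) {S : PSpace F n} (hSC : S ≤ C) (hS : finrank F S = r - w) :
    {D | D ∈ 𝒞 ∧ S ≤ D}.ncard ≤ Fintype.card F ^ ((n - r) * (w + 1 - d)) := by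
  have hCr := hdim C hC
  -- The analogue of puncturing: intersecting codewords with `C₁ ⊔ Q` lowers their dimension to `r +
  -- 1 - d`. That is one more than two distinct codewords can share, so the map is injective.
  obtain ⟨C₁, h1, h2, h3⟩ := exists_between_finrank_eq hSC (k := r + 1 - d) (by omega) (by omega)
  have hQn : r + finrank F Q = n := by
    have := Submodule.finrank_add_eq_of_isCompl (hQ C hC)
    rw [hCr, finrank_fin_fun] at this
    exact this
  have sup_dim : ∀ R ≤ C, finrank F (R ⊔ Q : PSpace F n) = finrank F R + (n - r) := by
    intro R hR
    have h5 := Submodule.finrank_sup_add_finrank_inf_eq R Q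
    rw [((hQ C hC).disjoint.mono_left hR).eq_bot, finrank_bot] at h5
    omega
  have hY := sup_dim C₁ h2
  have hX := sup_dim S hSC
  have hDY : ∀ D ∈ 𝒞, finrank F (D ⊓ (C₁ ⊔ Q) : PSpace F n) = r + 1 - d := by
    intro D hD
    have h5 := Submodule.finrank_sup_add_finrank_inf_eq D (C₁ ⊔ Q)
    have h6 : D ⊔ (C₁ ⊔ Q) = ⊤ := by
      rw [eq_top_iff, ← (hQ D hD).sup_eq_top]
      exact sup_le_sup_left le_sup_right _
    rw [h6, finrank_top, finrank_fin_fun, hdim D hD] at h5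
    omega
  refine le_trans ?_ (ncard_extensions_le_pow (S := S) (X := S ⊔ Q) (Y := C₁ ⊔ Q)
    (k := w + 1 - d) (m := n - r) le_sup_left (sup_le_sup_right h1 Q) (by omega) (by omega))
  refine Set.ncard_le_ncard_of_injOn (fun D => D ⊓ (C₁ ⊔ Q)) ?_ ?_ (Set.toFinite _)
  · rintro D ⟨hD, hSD⟩
    refine ⟨inf_le_right, ?_, by have := hDY D hD; omega⟩
    -- By the modular law `D ⊓ (S ⊔ Q) = S ⊔ (D ⊓ Q) = S`, so the intersections are extensions of
    -- `S` relative to `S ⊔ Q`.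
    rw [inf_assoc, inf_eq_right.2 (sup_le_sup_right h1 Q), inf_comm, sup_inf_assoc_of_le _ hSD,
      inf_comm, (hQ D hD).inf_eq_bot, sup_bot_eq]
  · rintro D ⟨hD, -⟩ D' ⟨hD', -⟩ h
    by_contra hne
    have h5 := hd D hD D' hD' hne
    have h6 : finrank F (D ⊓ (C₁ ⊔ Q) : PSpace F n) ≤ finrank F (D ⊓ D' : PSpace F n) := by
      refine Submodule.finrank_mono (le_inf inf_le_left ?_)
      have h7 : D ⊓ (C₁ ⊔ Q) = D' ⊓ (C₁ ⊔ Q) := h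
      rw [h7]
      exact inf_le_left
    have h7 := dI_add_finrank_inf D D'
    rw [hDY D hD] at h6
    rw [hdim D hD, hdim D' hD'] at h7
    omega

/-- The distance distribution compared with that of the set of all subspaces of dimension `r`. -/
theorem A_mul_pow_le (hdim : ∀ U ∈ 𝒞, finrank F U = r) (hQ : ∀ U ∈ 𝒞, IsCompl U Q)
    (hd : ∀ U ∈ 𝒞, ∀ V ∈ 𝒞, U ≠ V → d ≤ dI U V) (hC : C ∈ 𝒞) (hd0 : 0 < d) (hdw : d ≤ w)
    (hwr : w ≤ r) (hrn : 2 * r ≤ n) :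
    A 𝒞 C w * Fintype.card F ^ ((n - r) * (d - 1)) ≤
      {D : PSpace F n | finrank F D = r ∧ dI D C = w}.ncard := by
  classical
  have hCr := hdim C hC
  have hfin : {S : PSpace F n | S ≤ C ∧ finrank F S = r - w}.Finite := Set.toFinite _
  rw [A, ncard_eq_sum_fiberwise _ (fun D => D ⊓ C) hfin.toFinset,
    ncard_eq_sum_fiberwise {D : PSpace F n | finrank F D = r ∧ dI D C = w} (fun D => D ⊓ C)
      hfin.toFinset, Finset.sum_mul]
  · refine Finset.sum_le_sum fun S hS => ?_
    obtain ⟨hSC, hSr⟩ := hfin.mem_toFinset.1 hS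
    calc _ ≤ Fintype.card F ^ ((n - r) * (w + 1 - d)) *
          Fintype.card F ^ ((n - r) * (d - 1)) := by
          refine Nat.mul_le_mul_right _ (le_trans (Set.ncard_le_ncard ?_ (Set.toFinite _))
            (ncard_codewords_ge_le hdim hQ hd hC hd0 hdw hwr hSC hSr))
          rintro D ⟨⟨a1, a2⟩, a3⟩
          exact ⟨a1, by rw [← a3]; exact inf_le_left⟩
      _ = Fintype.card F ^ ((n - r) * w) := by
          rw [← pow_add, ← mul_add, show w + 1 - d + (d - 1) = w by omega]
      -- Here `2 * r ≤ n` is what gives `w ≤ n - r`, the dimension condition of the lower bound.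
      _ ≤ (extensions S C ⊤ w).ncard :=
          pow_le_ncard_extensions hSC le_top (by rw [finrank_top, finrank_fin_fun]; omega)
            (by omega)
      _ ≤ _ := by
          refine Set.ncard_le_ncard ?_ (Set.toFinite _)
          rintro D ⟨-, a2, a3⟩
          have a4 : finrank F D = r := by omega
          refine ⟨⟨a4, ?_⟩, a2⟩
          have := dI_add_finrank_inf D C
          rw [a2, a4, hCr] at this
          omega
  · rintro D ⟨a1, a2⟩
    exact hfin.mem_toFinset.2 ⟨inf_le_right, by rw [finrank_inf_eq_of_dI hCr a1, a2]⟩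
  · rintro D ⟨a1, a2⟩
    exact hfin.mem_toFinset.2 ⟨inf_le_right, by rw [finrank_inf_eq_of_dI hCr (hdim D a1), a2]⟩

end Distribution

/-! ## Volumes of balls -/

section Balls

variable {F : Type*} [Field F] [Fintype F] {n r v t δ : ℕ}

/-- Choose `S = D ⊓ X` inside `X`, then extend `S` to `D` without enlarging the intersection; each
choice costs one factor `K⁻¹`. -/
theorem ncard_finrank_inf_eq_le (X : PSpace F n) {k : ℕ} (hkX : k ≤ finrank F X) (hkr : k ≤ r)
    (hrn : r ≤ n) :
    ({D : PSpace F n | finrank F D = r ∧ finrank F (D ⊓ X : PSpace F n) = k}.ncard : ℝ) ≤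
      (K (Fintype.card F) ^ 2)⁻¹ *
        (Fintype.card F : ℝ) ^ (k * (finrank F X - k) + (r - k) * (n - r)) := by
  classical
  have hK := K_pos (one_lt_card_real F)
  have hfin : (extensions (⊥ : PSpace F n) ⊥ X k).Finite := Set.toFinite _
  rw [ncard_eq_sum_fiberwise _ (fun D => D ⊓ X) hfin.toFinset, Nat.cast_sum]
  · have h1 : ∀ S ∈ hfin.toFinset,
        (({D | D ∈ {D : PSpace F n | finrank F D = r ∧ finrank F (D ⊓ X : PSpace F n) = k} ∧
          D ⊓ X = S}.ncard : ℕ) : ℝ) ≤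
          (K (Fintype.card F))⁻¹ * (Fintype.card F : ℝ) ^ ((n - r) * (r - k)) := by
      intro S hS
      obtain ⟨a1, -, a3⟩ := hfin.mem_toFinset.1 hS
      rw [finrank_bot, zero_add] at a3
      refine le_trans ?_ (ncard_extensions_le a1 (le_top : X ≤ ⊤)
        (by rw [finrank_top, finrank_fin_fun]; omega))
      refine Nat.cast_le.2 (Set.ncard_le_ncard ?_ (Set.toFinite _))
      rintro D ⟨⟨b1, b2⟩, b3⟩
      exact ⟨le_top, b3, by omega⟩
    refine (Finset.sum_le_card_nsmul _ _ _ h1).trans ?_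
    have h2 := ncard_extensions_le (le_rfl : (⊥ : PSpace F n) ≤ ⊥) (bot_le : ⊥ ≤ X) (k := k)
      (m := finrank F X - k) (by rw [finrank_bot]; omega)
    rw [Set.ncard_eq_toFinset_card _ hfin] at h2
    rw [nsmul_eq_mul]
    refine (mul_le_mul_of_nonneg_right h2 (by positivity)).trans_eq ?_
    rw [pow_add, sq, mul_inv, mul_comm k, mul_comm (r - k)]
    ring
  · rintro D ⟨a1, a2⟩
    exact hfin.mem_toFinset.2 ⟨inf_le_right, inf_bot_eq _, by rw [finrank_bot, zero_add, a2]⟩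

theorem ncard_ball_le {X : PSpace F n} (hX : finrank F X = v) (hrn : r ≤ n)
    (hδ : δ = max r v - min r v) (hδt : δ ≤ t) (htr : t ≤ r) :
    ({D : PSpace F n | finrank F D = r ∧ dI D X ≤ t}.ncard : ℝ) ≤
      ∑ j ∈ range (t - δ + 1), (K (Fintype.card F) ^ 2)⁻¹ *
        (Fintype.card F : ℝ) ^ ((max r v + j - t) * (v - (max r v + j - t)) +
          (r - (max r v + j - t)) * (n - r)) := by
  -- The index `j = t - dI D X` puts the outermost layer, whose bound dominates, at `j = 0`; it
  -- stops at `t - δ` because `δ ≤ dI D X`.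
  rw [ncard_eq_sum_fiberwise _ (fun D => t - dI D X) (range (t - δ + 1)), Nat.cast_sum]
  · refine Finset.sum_le_sum fun j hj => ?_
    have hj' := mem_range.1 hj
    subst hX
    refine le_trans (Nat.cast_le.2 (Set.ncard_le_ncard ?_ (Set.toFinite _)))
      (ncard_finrank_inf_eq_le X (k := max r (finrank F X) + j - t) (by omega) (by omega) hrn)
    rintro D ⟨⟨b1, b2⟩, b3⟩
    refine ⟨b1, ?_⟩
    have := dI_add_finrank_inf D X
    rw [b1] at this
    omega
  · rintro D ⟨b1, b2⟩
    have := max_sub_min_le_dI D X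
    rw [b1, hX] at this
    exact mem_range.2 (by omega)

end Balls

/-! ## The upper bound -/

section UpperBound

variable {F : Type*} [Field F] [Fintype F] {n r d t v μ δ : ℕ} {𝒞 : Set (PSpace F n)}
  {C Q : PSpace F n}

theorem sum_nearCount (C : PSpace F n) (s : Finset (PSpace F n)) (μ v t : ℕ) :
    ∑ D ∈ s, nearCount C D μ v t =
      ∑ X ∈ (Set.toFinite (sphere C μ v)).toFinset, {D | D ∈ s ∧ dI D X ≤ t}.ncard := by
  classical
  have h := Finset.sum_card_bipartiteAbove_eq_sum_card_bipartiteBelow (s := s)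
    (t := (Set.toFinite (sphere C μ v)).toFinset) (fun D X => dI D X ≤ t)
  refine Eq.trans (Finset.sum_congr rfl fun D _ => ?_) (h.trans (Finset.sum_congr rfl fun X _ => ?_))
  · rw [nearCount, ← Set.ncard_coe_finset]
    congr 1
    ext X
    simp [Finset.bipartiteAbove]
  · rw [← Set.ncard_coe_finset]
    congr 1
    ext D
    simp [Finset.bipartiteBelow]

/-- In the exact count, `A 𝒞 C w` times the power of `q` is at most the number of all
`r`-dimensional subspaces at distance `w`. The sum then counts pairs `(D, X)` and can be reorganised
by `X`. -/
theorem ncard_errorSet_mul_pow_le (hdim : ∀ U ∈ 𝒞, finrank F U = r)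
    (hQ : ∀ U ∈ 𝒞, IsCompl U Q) (hd : ∀ U ∈ 𝒞, ∀ V ∈ 𝒞, U ≠ V → d ≤ dI U V)
    (htd : 2 * t < d) (hC : C ∈ 𝒞) (hrn : 2 * r ≤ n)
    (hδ : δ = max r v - min r v) (hμ : d - t + δ ≤ μ) (ht : δ ≤ t) :
    (errorSet 𝒞 C t ∩ sphere C μ v).ncard * Fintype.card F ^ ((n - r) * (d - 1)) ≤
      ∑ X ∈ (Set.toFinite (sphere C μ v)).toFinset,
        {D : PSpace F n | finrank F D = r ∧ dI D X ≤ t}.ncard := by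
  classical
  have hfin : {D : PSpace F n | finrank F D = r ∧ dI D C ∈ Icc d r}.Finite := Set.toFinite _
  rw [ncard_errorSet_inter_sphere hdim hd htd hC hδ hμ ht, Finset.sum_mul]
  calc _ ≤ ∑ w ∈ Icc d r, {D : PSpace F n | finrank F D = r ∧ dI D C = w}.ncard *
        ∑ s ∈ range (2 * t - δ + 1), JS F n (2 * μ - δ) s (2 * w) r r v := by
        refine Finset.sum_le_sum fun w hw => ?_
        rw [mul_right_comm]
        exact Nat.mul_le_mul_right _ (A_mul_pow_le hdim hQ hd hC (by omega)
          (mem_Icc.1 hw).1 (mem_Icc.1 hw).2 hrn)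
    _ = ∑ D ∈ hfin.toFinset, nearCount C D μ v t := by
        rw [← Finset.sum_fiberwise_of_maps_to (t := Icc d r) (g := fun D => dI D C)
          fun D hD => (hfin.mem_toFinset.1 hD).2]
        refine Finset.sum_congr rfl fun w hw => ?_
        have h5 : {D : PSpace F n | finrank F D = r ∧ dI D C = w}.ncard =
            #{D ∈ hfin.toFinset | dI D C = w} := by
          rw [← Set.ncard_coe_finset]
          congr 1
          ext D
          simp only [Finset.coe_filter, Set.Finite.mem_toFinset, Set.mem_ofPred_eq]
          exact ⟨fun a => ⟨⟨a.1, a.2 ▸ hw⟩, a.2⟩, fun a => ⟨a.1.1, a.2⟩⟩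
        rw [h5, ← smul_eq_mul, ← Finset.sum_const]
        refine Finset.sum_congr rfl fun D hD => ?_
        obtain ⟨hD', rfl⟩ := Finset.mem_filter.1 hD
        rw [nearCount_eq_sum_JS (hdim C hC) (hfin.mem_toFinset.1 hD').1 hδ (by omega) ht]
    _ ≤ _ := by
        -- After the exchange of summations, the restriction on `dI D C` is dropped, leaving full
        -- balls around the points of the sphere.
        rw [sum_nearCount]
        refine Finset.sum_le_sum fun X _ => Set.ncard_le_ncard ?_ (Set.toFinite _)
        rintro D ⟨a1, a2⟩
        exact ⟨(hfin.mem_toFinset.1 a1).1, a2⟩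

/-- The exponents of the successive terms in the volume of a ball decrease at least
quadratically. -/
theorem ball_exponent_le {j : ℕ} (hrn : r ≤ n) (htr : 2 * t ≤ n) (htr' : t ≤ r)
    (hδ : δ = max r v - min r v) (hj : j + δ ≤ t) :
    (((max r v + j - t) * (v - (max r v + j - t)) +
        (r - (max r v + j - t)) * (n - r) : ℕ) : ℝ) ≤
      (-((t : ℝ) + ((v : ℝ) - r) / 2) * ((n : ℝ) - 2 * r + t - ((v : ℝ) - r) / 2)
        - |(v : ℝ) - r| / 2 * ((n : ℝ) - 2 * t + |(v : ℝ) - r| / 2)) + ((n : ℝ) - r) * (2 * t)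
        + -(3 / 4 : ℝ) * (j : ℝ) ^ 2 := by
  have h1 : (0 : ℝ) ≤ (j : ℝ) * ((n : ℝ) - 2 * t) :=
    mul_nonneg j.cast_nonneg (sub_nonneg.2 (by exact_mod_cast htr))
  have h2 : (0 : ℝ) ≤ (j : ℝ) ^ 2 := by positivity
  rcases le_total r v with h | h
  · obtain ⟨e, rfl⟩ := Nat.exists_eq_add_of_le h
    have h3 : (0 : ℝ) ≤ (j : ℝ) * e := by positivity
    rw [max_eq_right h]
    push_cast [Nat.cast_sub (show t ≤ r + e + j by omega),
      Nat.cast_sub (show r + e + j - t ≤ r + e by omega),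
      Nat.cast_sub (show r + e + j - t ≤ r by omega), Nat.cast_sub hrn]
    rw [add_sub_cancel_left, abs_of_nonneg (by positivity : (0 : ℝ) ≤ e)]
    -- The right side minus the left is exactly `j * (n - 2 * t) + j * e + j ^ 2 / 4`, with equality
    -- at `j = 0`; the case `v ≤ r` leaves the same defect.
    linarith
  · obtain ⟨e, rfl⟩ := Nat.exists_eq_add_of_le h
    have h3 : (0 : ℝ) ≤ (j : ℝ) * e := by positivity
    rw [max_eq_left h]
    push_cast [Nat.cast_sub (show t ≤ v + e + j by omega),
      Nat.cast_sub (show v + e + j - t ≤ v by omega),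
      Nat.cast_sub (show v + e + j - t ≤ v + e by omega), Nat.cast_sub hrn]
    rw [sub_add_cancel_left, abs_neg, abs_of_nonneg (by positivity : (0 : ℝ) ≤ e)]
    linarith

/-- The term with `d - 1 - 2 * t` treats both parities of `d` at once: it is what remains of the
saving `(n - r) * (d - 1)` after the ball volume has used up `2 * t * (n - r)`. -/
theorem DEP_lt {W : OperatorChannel F n} (hW : W.IsSymmetric)
    (hdim : ∀ U ∈ 𝒞, finrank F U = r)
    (hQ : ∀ U ∈ 𝒞, IsCompl U Q) (hd : ∀ U ∈ 𝒞, ∀ V ∈ 𝒞, U ≠ V → d ≤ dI U V)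
    (htd : 2 * t < d) (hdr : d ≤ r) (hC : C ∈ 𝒞) (hrn : 2 * r ≤ n) :
    DEP W 𝒞 C μ v t < L (Fintype.card F) * (Fintype.card F : ℝ) ^
      (-((t : ℝ) + ((v : ℝ) - r) / 2) * ((n : ℝ) - 2 * r + t - ((v : ℝ) - r) / 2)
        - |(v : ℝ) - r| / 2 * ((n : ℝ) - 2 * t + |(v : ℝ) - r| / 2)
        - ((n : ℝ) - r) * ((d : ℝ) - 1 - 2 * t)) := by
  have hq := one_lt_card_real F
  have hq0 : (0 : ℝ) < Fintype.card F := by linarith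
  have hK := K_pos hq
  have hpos := mul_pos (L_pos hq) (Real.rpow_pos_of_pos hq0
    (-((t : ℝ) + ((v : ℝ) - r) / 2) * ((n : ℝ) - 2 * r + t - ((v : ℝ) - r) / 2)
        - |(v : ℝ) - r| / 2 * ((n : ℝ) - 2 * t + |(v : ℝ) - r| / 2)
        - ((n : ℝ) - r) * ((d : ℝ) - 1 - 2 * t)))
  by_cases hne : (W C).toOuterMeasure (sphere C μ v) = 0
  · rw [DEP_eq_zero_of_measure_sphere_eq_zero 𝒞 t hne]
    exact hpos
  rw [DEP_eq_div hW 𝒞 t hne]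
  obtain ⟨δ, hδ⟩ : ∃ δ, δ = max r v - min r v := ⟨_, rfl⟩
  by_cases hcond : d - t + δ ≤ μ ∧ δ ≤ t
  swap
  · rw [not_mem_errorSet_of_mem_sphere hdim hd (by omega) hC hδ hcond, Set.ncard_empty,
      Nat.cast_zero, zero_div]
    exact hpos
  obtain ⟨hμ, hδt⟩ := hcond
  have hsp : (0 : ℝ) < (sphere C μ v).ncard := by
    rw [Nat.cast_pos, Set.ncard_pos (Set.toFinite _), Set.nonempty_iff_ne_empty]
    intro h'
    exact hne (by rw [h', MeasureTheory.measure_empty])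
  rw [div_lt_iff₀ hsp]
  have h1 := ncard_errorSet_mul_pow_le hdim hQ hd htd hC hrn hδ hμ hδt
  have h2 := (Nat.cast_le (α := ℝ)).2 h1
  rw [Nat.cast_mul, Nat.cast_pow, Nat.cast_sum] at h2
  have h3 := h2.trans (Finset.sum_le_card_nsmul _ _ _ fun X hX =>
    ncard_ball_le ((Set.Finite.mem_toFinset _).1 hX).1 (by omega) hδ hδt (by omega))
  rw [← Set.ncard_eq_toFinset_card, nsmul_eq_mul] at h3
  set T : ℝ := -((t : ℝ) + ((v : ℝ) - r) / 2) * ((n : ℝ) - 2 * r + t - ((v : ℝ) - r) / 2)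
        - |(v : ℝ) - r| / 2 * ((n : ℝ) - 2 * t + |(v : ℝ) - r| / 2) with hT
  have h4 : ∑ j ∈ range (t - δ + 1), (K (Fintype.card F) ^ 2)⁻¹ *
        (Fintype.card F : ℝ) ^ ((max r v + j - t) * (v - (max r v + j - t)) +
          (r - (max r v + j - t)) * (n - r)) <
      L (Fintype.card F) * (Fintype.card F : ℝ) ^ (T + ((n : ℝ) - r) * (2 * t)) := by
    rw [← Finset.mul_sum, L, mul_assoc]
    refine mul_lt_mul_of_pos_left ?_ (by positivity)
    refine lt_of_le_of_lt ?_ (mul_lt_mul_of_pos_right (sum_lt_tsum_rpow_neg_sq hq (t - δ + 1))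
      (by positivity))
    rw [Finset.sum_mul]
    refine Finset.sum_le_sum fun j hj => ?_
    have hj' := mem_range.1 hj
    rw [← Real.rpow_add hq0, ← Real.rpow_natCast, add_comm]
    rw [add_comm (-(3 / 4 : ℝ) * (j : ℝ) ^ 2)]
    rw [add_comm ((r - (max r v + j - t)) * (n - r))]
    exact Real.rpow_le_rpow_of_exponent_le hq.le
      (ball_exponent_le (by omega) (by omega) (by omega) hδ (by omega))
  have h5 := h3.trans_lt (mul_lt_mul_of_pos_left h4 hsp)
  have h6 : (Fintype.card F : ℝ) ^ (T + ((n : ℝ) - r) * (2 * t)) =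
      (Fintype.card F : ℝ) ^ (T - ((n : ℝ) - r) * ((d : ℝ) - 1 - 2 * t)) *
        (Fintype.card F : ℝ) ^ ((n - r) * (d - 1)) := by
    rw [← Real.rpow_natCast, ← Real.rpow_add hq0]
    push_cast [Nat.cast_sub (show r ≤ n by omega), Nat.cast_sub (show 1 ≤ d by omega)]
    ring_nf
  rw [h6, ← mul_assoc, ← mul_assoc] at h5
  have h7 := lt_of_mul_lt_mul_right h5 (by positivity)
  linarith

end UpperBound

end CDC

/-! ### The exact formula, the vanishing range and the bound for lifted codes -/

theorem proposition7 {F : Type*} [Field F] [Fintype F] (n r d t : ℕ) (hrn : r ≤ n)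
    (𝒞 : Set (PSpace F n)) (hdim : ∀ U ∈ 𝒞, Module.finrank F U = r)
    (hd : CDC.IsMinInjDist 𝒞 d) (ht : t = (d - 1) / 2)
    (W : CDC.OperatorChannel F n) (hW : W.IsSymmetric)
    (C : PSpace F n) (hC : C ∈ 𝒞) (v μ δ : ℕ) (hδ : (δ : ℤ) = |(v : ℤ) - (r : ℤ)|) :
    ((W C).toOuterMeasure (CDC.sphere C μ v) ≠ 0 → d - t + δ ≤ μ → δ ≤ t →
      CDC.DEP W 𝒞 C μ v t =
        1 / (CDC.NS F n r v (2 * μ - δ) : ℝ) *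
          ∑ w ∈ Finset.Icc d r, (CDC.A 𝒞 C w : ℝ) *
            ∑ s ∈ Finset.range (2 * t - δ + 1),
              (CDC.JS F n (2 * μ - δ) s (2 * w) r r v : ℝ)) ∧
    (¬ (d - t + δ ≤ μ ∧ δ ≤ t) → CDC.DEP W 𝒞 C μ v t = 0) ∧
    (2 * r ≤ n →
      ∀ 𝓡 : Set (Matrix (Fin r) (Fin (n - r)) F), 𝒞 = CDC.lift hrn '' 𝓡 →
        (d = 2 * t + 1 →
          CDC.DEP W 𝒞 C μ v t <
            CDC.L (Fintype.card F) * (Fintype.card F : ℝ) ^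
              (-((t : ℝ) + ((v : ℝ) - r) / 2) * ((n : ℝ) - 2 * r + t - ((v : ℝ) - r) / 2)
                - |(v : ℝ) - r| / 2 * ((n : ℝ) - 2 * t + |(v : ℝ) - r| / 2))) ∧
        (d = 2 * t + 2 →
          CDC.DEP W 𝒞 C μ v t <
            CDC.L (Fintype.card F) * (Fintype.card F : ℝ) ^
              (-((t : ℝ) + ((v : ℝ) - r) / 2) * ((n : ℝ) - 2 * r + t - ((v : ℝ) - r) / 2)
                - |(v : ℝ) - r| / 2 * ((n : ℝ) - 2 * t + |(v : ℝ) - r| / 2)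
                - (n : ℝ) + r))) := by

  obtain ⟨⟨U₀, hU₀, V₀, hV₀, hne, hUV⟩, hmin⟩ := hd
  have hd' : ∀ U ∈ 𝒞, ∀ V ∈ 𝒞, U ≠ V → d ≤ CDC.dI U V :=
    fun U hU V hV h => hmin ⟨U, hU, V, hV, h, rfl⟩
  have hdr : d ≤ r := by
    rw [← hUV, ← hdim V₀ hV₀]
    exact CDC.dI_le_of_finrank_eq (by rw [hdim U₀ hU₀, hdim V₀ hV₀])
  have hd0 : 0 < d := by
    by_contra h0
    have h1 := CDC.dI_add_finrank_inf U₀ V₀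
    rw [hUV, hdim U₀ hU₀, hdim V₀ hV₀, max_self] at h1
    have h2 : U₀ ⊓ V₀ = U₀ :=
      Submodule.eq_of_le_of_finrank_eq inf_le_left (by rw [hdim U₀ hU₀]; omega)
    have h3 : U₀ ⊓ V₀ = V₀ :=
      Submodule.eq_of_le_of_finrank_eq inf_le_right (by rw [hdim V₀ hV₀]; omega)
    exact hne (h2.symm.trans h3)
  -- Positivity of `d` is essential: for `d = 0` the truncated `(d - 1) / 2` would be `0` and the
  -- inequality would fail.
  have htd : 2 * t < d := by omega
  have hδ' : δ = max r v - min r v := by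
    rcases abs_cases ((v : ℤ) - r) with h | h <;> omega
  refine ⟨fun hpos hμ hδt => ?_, fun h => ?_, fun h2r 𝓡 h𝓡 => ?_⟩
  · rw [CDC.DEP_eq_div hW 𝒞 t hpos,
      CDC.ncard_errorSet_inter_sphere hdim hd' htd hC hδ' hμ hδt,
      CDC.ncard_sphere (hdim C hC) hδ' (by omega), div_eq_inv_mul, one_div]
    push_cast
    rfl
  · by_cases hpos : (W C).toOuterMeasure (CDC.sphere C μ v) = 0
    · exact CDC.DEP_eq_zero_of_measure_sphere_eq_zero 𝒞 t hpos
    · rw [CDC.DEP_eq_div hW 𝒞 t hpos,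
        CDC.not_mem_errorSet_of_mem_sphere hdim hd' (by omega) hC hδ' h, Set.ncard_empty,
        Nat.cast_zero, zero_div]
  · have hQ : ∀ U ∈ 𝒞, IsCompl U (LinearMap.ker (CDC.firstCoords F hrn)) := by
      rw [h𝓡]
      rintro _ ⟨M, -, rfl⟩
      exact CDC.isCompl_lift_ker_firstCoords hrn M
    have key := CDC.DEP_lt (μ := μ) (v := v) hW hdim hQ hd' htd hdr hC h2r
    -- The term `(n - r) * (d - 1 - 2 * t)` becomes `0` for `d = 2 * t + 1` and `n - r` for `d = 2 *
    -- t + 2`.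
    constructor <;> intro hdt <;> refine key.trans_eq ?_ <;> rw [hdt] <;> push_cast <;> ring_nf
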